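/- Let $L\ge 2$ be an integer and let $l>0$. Cut a solid cube of side length $Ll$ into $L^3$ identical unit cells (cubes of side length $l$) along the grid planes; each cell has its own $8$ vertices, so the configuration has $24L^3$ real coordinates. For each cell impose the $12$ edge length constraints $\|v_i-v_j\|^2-l^2=0$ ($v_i,v_j$ adjacent vertices of the cell) and the $6$ diagonal length constraints $\|v_i-v_j\|^2-2l^2=0$ (one pair of opposite vertices $v_i,v_j$ in each of the $6$ faces of the cell; which of the two diagonals of a face is used may be chosen arbitrarily). An infinitesimal link joins two vertices $v_i,v_j$ of two distinct cells that coincide in the undeformed solid, and imposes the three constraints $v_i-v_j=0$ (one for each coordinate). A link pattern is a finite set of such links. For a link pattern with $n$ links, let $A$ be the rigidity matrix, i.e. the $(18L^3+3n)\times 24L^3$ matrix of partial derivatives of all constraint functions with respect to all coordinates, evaluated at the undeformed configuration; the number of degrees of freedom is $d=24L^3-\operatorname{rank}(A)$, and the pattern is called rigidifying if $d=6$. Then, for every such choice of diagonals, rigidifying link patterns exist, and the minimum number $\delta_{3D}(L)$ of links in a rigidifying link pattern for the $L\times L\times L$ assembly is $$\delta_{3D}(L)=2L^3-2 .$$ 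-/

import Mathlib

noncomputable section

namespace PrismaticAssembly

/-- The cubes of an `L × M × N` assembly, indexed by their position in the grid. -/
abbrev Cube (L M N : ℕ) : Type := Fin L × Fin M × Fin N

/-- The eight corners of a cube; the `c`-th bit tells whether the corner lies on the upper side of
the cube in direction `c`. -/
abbrev Corner : Type := Fin 3 → Bool

/-- The nodes of the assembly: every cube has its own eight vertices. -/
abbrev Node (L M N : ℕ) : Type := Cube L M N × Corner

/-- The `24 L M N` coordinates: three for each node. -/
abbrev Coord (L M N : ℕ) : Type := Node L M N × Fin 3

/-- A configuration assigns a real value to every coordinate. -/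
abbrev Config (L M N : ℕ) : Type := Coord L M N → ℝ

/-- The position of a node in a configuration, as a point of Euclidean 3-space. -/
def position {L M N : ℕ} (x : Config L M N) (v : Node L M N) : EuclideanSpace ℝ (Fin 3) :=
  WithLp.toLp 2 fun c => x (v, c)

/-- The grid point at which a node sits in the undeformed solid (in units of the side length). -/
def gridPoint {L M N : ℕ} (v : Node L M N) : Fin 3 → ℕ :=
  ![v.1.1 + (v.2 0).toNat, v.1.2.1 + (v.2 1).toNat, v.1.2.2 + (v.2 2).toNat]

/-- The undeformed configuration of the assembly of cubes of side length `l`. -/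
def rest (l : ℝ) (L M N : ℕ) : Config L M N := fun p => l * gridPoint p.1 p.2

/-- The twelve edges of a cube: an axis, and the bits of the two other coordinates. -/
abbrev CubeEdge : Type := Fin 3 × (Fin 2 → Bool)

/-- The six faces of a cube: the normal axis, and the side on which the face lies. -/
abbrev CubeFace : Type := Fin 3 × Bool

/-- The two ends of an edge of a cube. -/
def edgeEnds (e : CubeEdge) : Corner × Corner :=
  (Fin.insertNth e.1 false e.2, Fin.insertNth e.1 true e.2)

/-- The two ends of one of the two diagonals of a face of a cube; the bit `d` selects the
diagonal. -/
def diagonalEnds (f : CubeFace) (d : Bool) : Corner × Corner :=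
  (Fin.insertNth f.1 f.2 ![false, d], Fin.insertNth f.1 f.2 ![true, !d])

/-- The possible links: they join two vertices of distinct cubes that occupy the same point of the
undeformed solid. -/
def linkGraph (L M N : ℕ) : SimpleGraph (Node L M N) where
  Adj u v := u.1 ≠ v.1 ∧ gridPoint u = gridPoint v
  symm := ⟨fun _ _ h => ⟨h.1.symm, h.2.symm⟩⟩
  loopless := ⟨fun _ h => h.1 rfl⟩

/-- A link pattern is a finite set of possible links. -/
def IsLinkPattern {L M N : ℕ} (P : Finset (Sym2 (Node L M N))) : Prop :=
  ∀ e ∈ P, e ∈ (linkGraph L M N).edgeSet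

/-- The constraints: twelve edge lengths and six diagonal lengths per cube, and three equations per
link. -/
abbrev Constraint {L M N : ℕ} (P : Finset (Sym2 (Node L M N))) : Type :=
  (Cube L M N × CubeEdge) ⊕ (Cube L M N × CubeFace) ⊕ (P × Fin 3)

/-- The constraint functions. The choice `diag` tells which diagonal of each face of each cube is
used. A link is oriented arbitrarily; this affects only the sign of its three functions. -/
def constraintFun {L M N : ℕ} (l : ℝ) (diag : Cube L M N → CubeFace → Bool)
    (P : Finset (Sym2 (Node L M N))) : Constraint P → Config L M N → ℝ
  | .inl (q, e), x =>
      ‖position x (q, (edgeEnds e).1) - position x (q, (edgeEnds e).2)‖ ^ 2 - l ^ 2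
  | .inr (.inl (q, f)), x =>
      ‖position x (q, (diagonalEnds f (diag q f)).1)
        - position x (q, (diagonalEnds f (diag q f)).2)‖ ^ 2 - 2 * l ^ 2
  | .inr (.inr (e, c)), x => x ((Quot.out e.1).1, c) - x ((Quot.out e.1).2, c)

/-- The rigidity matrix: the partial derivatives of all constraint functions with respect to all
coordinates, at the undeformed configuration. -/
def rigidityMatrix {L M N : ℕ} (l : ℝ) (diag : Cube L M N → CubeFace → Bool)
    (P : Finset (Sym2 (Node L M N))) : Matrix (Constraint P) (Coord L M N) ℝ :=
  Matrix.of fun i j => fderiv ℝ (constraintFun l diag P i) (rest l L M N) (Pi.single j 1)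

/-- The number of infinitesimal degrees of freedom of the linked assembly. -/
def dof {L M N : ℕ} (l : ℝ) (diag : Cube L M N → CubeFace → Bool)
    (P : Finset (Sym2 (Node L M N))) : ℕ :=
  24 * L * M * N - (rigidityMatrix l diag P).rank

/-- The numbers of links of the link patterns that rigidify the `L × M × N` assembly. -/
def rigidifyingNumbers (l : ℝ) {L M N : ℕ} (diag : Cube L M N → CubeFace → Bool) : Set ℕ :=
  {n | ∃ P : Finset (Sym2 (Node L M N)), IsLinkPattern P ∧ P.card = n ∧ dof l diag P = 6}

end PrismaticAssembly

end

/-! ### Twists, joints and attachments. -/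

noncomputable section

namespace PrismaticAssembly

/-! The lower bound is a row count: the rank is at most `18 L³ + 3 n`, and six degrees of freedom
require rank `24 L³ - 6`, so `n ≥ 2 L³ - 2` (`rank_le`).

For the construction, the 18 constraints of one cell leave it only infinitesimal rigid motions,
whichever diagonals are used (`exists_twist_of_stretch_eq_zero`). A kernel vector is thus a family
of twists, one per cell, and each link equates two velocities at a point. Starting from one cell
without links, groups of cells are attached with two links, that is six equations, per new cell, so
that the new cells are held fixed (`Rigidifiable.attach`). A few explicit attachments suffice: every
layer with sides at least 2 splits into rectangles with sides 2 or 3 (`stackable`), and cyclic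
rotation lets a box grow in each direction (`rigidifiable_box`). -/

/-- A cube of the unbounded grid, named by its lowest corner; also a grid point. -/
abbrev Cell : Type := ℕ × ℕ × ℕ

/-- An infinitesimal rigid motion: an angular velocity (entries `0, 1, 2`) followed by the velocity
of the origin (entries `3, 4, 5`). -/
abbrev Twist : Type := Fin 6 → ℝ

/-- The velocity that a twist gives to a grid point. -/
def velocity (m : Twist) (p : Cell) : Fin 3 → ℝ :=
  ![m 3 + m 1 * p.2.2 - m 2 * p.2.1, m 4 + m 2 * p.1 - m 0 * p.2.2, m 5 + m 0 * p.2.1 - m 1 * p.1]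

/-- A joint between two cells at a grid point. -/
structure Joint where
  /-- the first cell -/
  fst : Cell
  /-- the second cell -/
  snd : Cell
  /-- the point at which the cells are joined -/
  point : Cell

/-- The joint is respected by a family of motions of the cells. -/
def Joint.Holds (j : Joint) (m : Cell → Twist) : Prop :=
  velocity (m j.fst) j.point = velocity (m j.snd) j.point

/-- The grid point `p` is one of the eight corners of the cell `q`. -/
abbrev IsCornerOf (p q : Cell) : Prop := q ≤ p ∧ p ≤ q + (1, 1, 1)

/-- The two cells are distinct and the point is a corner of both. -/
abbrev Joint.Valid (j : Joint) : Prop :=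
  j.fst ≠ j.snd ∧ IsCornerOf j.point j.fst ∧ IsCornerOf j.point j.snd

/-- Cells on a rigid base, whose joints leave them no motion relative to the base. -/
structure Attachment where
  /-- the fixed cells -/
  base : Finset Cell
  /-- the cells to be attached -/
  new : Finset Cell
  /-- the joints -/
  joints : List Joint
  valid : ∀ j ∈ joints, j.Valid
  mem : ∀ j ∈ joints, j.fst ∈ base ∪ new ∧ j.snd ∈ base ∪ new
  length_le : joints.length ≤ 2 * new.card
  rigid : ∀ m : Cell → Twist, (∀ q ∈ base, m q = 0) → (∀ j ∈ joints, j.Holds m) →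
    ∀ q ∈ new, m q = 0

/-! ### Explicit attachments, checked by linear algebra. -/

/-- Three cells that complete a single cell to a square. -/
def cornerAttachment : Attachment where
  base := {(0, 0, 0)}
  new := {(1, 0, 0), (1, 1, 0), (0, 1, 0)}
  joints := [⟨(1, 1, 0), (1, 0, 0), (2, 1, 0)⟩, ⟨(1, 0, 0), (0, 1, 0), (1, 1, 0)⟩,
    ⟨(0, 1, 0), (1, 1, 0), (1, 2, 0)⟩, ⟨(1, 0, 0), (0, 0, 0), (1, 0, 1)⟩,
    ⟨(1, 1, 0), (0, 0, 0), (1, 1, 1)⟩, ⟨(0, 1, 0), (0, 0, 0), (0, 1, 0)⟩]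
  valid := by decide
  mem := by decide
  length_le := by decide
  -- With the base at rest, six joints give 18 linear equations in the 18 twist entries of the new
  -- cells; `linarith` derives the vanishing of each entry. The later attachments are also square
  -- systems.
  rigid m hb hj := by
    simp only [Finset.mem_singleton, forall_eq] at hb
    simp [Joint.Holds, velocity, hb] at hj
    simp only [Finset.forall_mem_insert, Finset.mem_singleton, forall_eq, funext_iff,
      Fin.forall_fin_succ, IsEmpty.forall_iff, and_true]
    constructorm* _ ∧ _ <;> simp only [Fin.succ_zero_eq_one, Fin.succ_one_eq_two, Pi.zero_apply,
      Fin.reduceSucc] <;> linarith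

/-- A square of four cells on top of four others. -/
def squareAttachment : Attachment where
  base := {(0, 0, 0), (1, 0, 0), (1, 1, 0), (0, 1, 0)}
  new := {(0, 0, 1), (1, 0, 1), (1, 1, 1), (0, 1, 1)}
  joints := [⟨(0, 0, 1), (1, 0, 1), (1, 0, 2)⟩, ⟨(1, 0, 1), (1, 1, 1), (1, 1, 2)⟩,
    ⟨(1, 1, 1), (0, 1, 1), (1, 2, 1)⟩, ⟨(0, 1, 1), (0, 0, 1), (0, 1, 2)⟩,
    ⟨(0, 0, 1), (0, 0, 0), (0, 0, 1)⟩, ⟨(1, 0, 1), (1, 0, 0), (2, 0, 1)⟩,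
    ⟨(1, 1, 1), (1, 1, 0), (1, 1, 1)⟩, ⟨(0, 1, 1), (0, 1, 0), (0, 1, 1)⟩]
  valid := by decide
  mem := by decide
  length_le := by decide
  rigid m hb hj := by
    simp only [Finset.forall_mem_insert, Finset.mem_singleton, forall_eq] at hb
    simp [Joint.Holds, velocity, hb] at hj
    simp only [Finset.forall_mem_insert, Finset.mem_singleton, forall_eq, funext_iff,
      Fin.forall_fin_succ, IsEmpty.forall_iff, and_true]
    constructorm* _ ∧ _ <;> simp only [Fin.succ_zero_eq_one, Fin.succ_one_eq_two, Pi.zero_apply,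
      Fin.reduceSucc] <;> linarith

/-- A square without its last cell, on top of three other cells. -/
def lowerTrominoAttachment : Attachment where
  base := {(0, 0, 0), (1, 0, 0), (0, 1, 0)}
  new := {(0, 0, 1), (1, 0, 1), (0, 1, 1)}
  joints := [⟨(0, 0, 1), (1, 0, 1), (1, 0, 2)⟩, ⟨(1, 0, 1), (0, 1, 1), (1, 1, 2)⟩,
    ⟨(0, 1, 1), (0, 0, 1), (0, 1, 2)⟩, ⟨(0, 0, 1), (0, 0, 0), (0, 0, 1)⟩,
    ⟨(1, 0, 1), (1, 0, 0), (2, 0, 1)⟩, ⟨(0, 1, 1), (0, 1, 0), (0, 1, 1)⟩]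
  valid := by decide
  mem := by decide
  length_le := by decide
  rigid m hb hj := by
    simp only [Finset.forall_mem_insert, Finset.mem_singleton, forall_eq] at hb
    simp [Joint.Holds, velocity, hb] at hj
    simp only [Finset.forall_mem_insert, Finset.mem_singleton, forall_eq, funext_iff,
      Fin.forall_fin_succ, IsEmpty.forall_iff, and_true]
    constructorm* _ ∧ _ <;> simp only [Fin.succ_zero_eq_one, Fin.succ_one_eq_two, Pi.zero_apply,
      Fin.reduceSucc] <;> linarith

/-- A square without its first cell, on top of three other cells. -/
def upperTrominoAttachment : Attachment where
  base := {(1, 0, 0), (1, 1, 0), (0, 1, 0)}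
  new := {(1, 0, 1), (1, 1, 1), (0, 1, 1)}
  joints := [⟨(1, 1, 1), (1, 0, 1), (2, 1, 2)⟩, ⟨(1, 0, 1), (0, 1, 1), (1, 1, 2)⟩,
    ⟨(0, 1, 1), (1, 1, 1), (1, 2, 2)⟩, ⟨(1, 0, 1), (1, 0, 0), (1, 0, 1)⟩,
    ⟨(1, 1, 1), (1, 1, 0), (1, 2, 1)⟩, ⟨(0, 1, 1), (0, 1, 0), (0, 2, 1)⟩]
  valid := by decide
  mem := by decide
  length_le := by decide
  rigid m hb hj := by
    simp only [Finset.forall_mem_insert, Finset.mem_singleton, forall_eq] at hb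
    simp [Joint.Holds, velocity, hb] at hj
    simp only [Finset.forall_mem_insert, Finset.mem_singleton, forall_eq, funext_iff,
      Fin.forall_fin_succ, IsEmpty.forall_iff, and_true]
    constructorm* _ ∧ _ <;> simp only [Fin.succ_zero_eq_one, Fin.succ_one_eq_two, Pi.zero_apply,
      Fin.reduceSucc] <;> linarith

set_option maxHeartbeats 1000000 in
/-- A square of side three without the three cells at its first corner, on top of six other cells. -/
def ringAttachment : Attachment where
  base := {(2, 0, 0), (2, 1, 0), (2, 2, 0), (1, 2, 0), (0, 2, 0), (1, 1, 0)}
  new := {(2, 0, 1), (2, 1, 1), (2, 2, 1), (1, 2, 1), (0, 2, 1), (1, 1, 1)}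
  joints := [⟨(2, 0, 1), (2, 1, 1), (2, 1, 1)⟩, ⟨(2, 1, 1), (2, 2, 1), (3, 2, 2)⟩,
    ⟨(2, 2, 1), (1, 2, 1), (2, 3, 2)⟩, ⟨(1, 2, 1), (0, 2, 1), (1, 2, 1)⟩,
    ⟨(0, 2, 1), (1, 1, 1), (1, 2, 2)⟩, ⟨(1, 1, 1), (2, 0, 1), (2, 1, 2)⟩,
    ⟨(2, 0, 1), (2, 0, 0), (2, 0, 1)⟩, ⟨(2, 1, 1), (2, 1, 0), (3, 1, 1)⟩,
    ⟨(2, 2, 1), (2, 2, 0), (3, 3, 1)⟩, ⟨(1, 2, 1), (1, 2, 0), (2, 3, 1)⟩,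
    ⟨(0, 2, 1), (0, 2, 0), (0, 2, 1)⟩, ⟨(1, 1, 1), (1, 1, 0), (1, 2, 1)⟩]
  valid := by decide
  mem := by decide
  length_le := by decide
  rigid m hb hj := by
    simp only [Finset.forall_mem_insert, Finset.mem_singleton, forall_eq] at hb
    simp [Joint.Holds, velocity, hb] at hj
    simp only [Finset.forall_mem_insert, Finset.mem_singleton, forall_eq, funext_iff,
      Fin.forall_fin_succ, IsEmpty.forall_iff, and_true]
    constructorm* _ ∧ _ <;> simp only [Fin.succ_zero_eq_one, Fin.succ_one_eq_two, Pi.zero_apply,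
      Fin.reduceSucc] <;> linarith

/-! ### Rigidifiable sets: gluing and rotation. -/

section

open Finset

/-- The cells of `S` can be joined to a rigid body as economically as the count of constraints
allows. -/
def Rigidifiable (S : Finset Cell) : Prop :=
  ∃ P : List Joint, (∀ j ∈ P, j.Valid) ∧ (∀ j ∈ P, j.fst ∈ S ∧ j.snd ∈ S) ∧
    P.length + 2 ≤ 2 * S.card ∧
    ∀ m : Cell → Twist, (∀ j ∈ P, j.Holds m) → ∀ q ∈ S, ∀ q' ∈ S, m q = m q'

/-- The twist in coordinates with origin `p`. -/
def Twist.shift (m : Twist) (p : Cell) : Twist :=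
  ![m 0, m 1, m 2, velocity m p 0, velocity m p 1, velocity m p 2]

theorem velocity_shift (m : Twist) (p r : Cell) :
    velocity (m.shift p) r = velocity m (p + r) := by
  ext c
  fin_cases c <;> simp [velocity, Twist.shift] <;> ring

theorem velocity_sub (m m' : Twist) (p : Cell) :
    velocity (m - m') p = velocity m p - velocity m' p := by
  ext c
  fin_cases c <;> simp [velocity] <;> ring

theorem Twist.eq_zero_of_shift {m : Twist} {p : Cell} (h : m.shift p = 0) : m = 0 := by
  have h0 : m 0 = 0 := congrFun h 0
  have h1 : m 1 = 0 := congrFun h 1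
  have h2 : m 2 = 0 := congrFun h 2
  have h3 : velocity m p 0 = 0 := congrFun h 3
  have h4 : velocity m p 1 = 0 := congrFun h 4
  have h5 : velocity m p 2 = 0 := congrFun h 5
  simp [velocity, h0, h1, h2] at h3 h4 h5
  ext c
  fin_cases c <;> assumption

/-- The joint moved by `p`. -/
def Joint.translate (p : Cell) (j : Joint) : Joint := ⟨p + j.fst, p + j.snd, p + j.point⟩

theorem Joint.Valid.translate {j : Joint} (h : j.Valid) (p : Cell) : (j.translate p).Valid := by
  obtain ⟨h1, ⟨h2, h3⟩, h4, h5⟩ := h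
  refine ⟨fun h => h1 (add_left_cancel h), ⟨add_le_add_right h2 p, ?_⟩, add_le_add_right h4 p, ?_⟩
  · simpa only [Joint.translate, add_assoc] using add_le_add_right h3 p
  · simpa only [Joint.translate, add_assoc] using add_le_add_right h5 p

/-- The old cells share one twist. Relative to it the base is at rest, so the attachment forces the
new cells to rest as well; the joint budget grows by at most two per new cell. -/
theorem Rigidifiable.attach {S S' : Finset Cell} (hS : Rigidifiable S) (A : Attachment) (p : Cell)
    (hbase : ∀ q ∈ A.base, p + q ∈ S) (hnew : ∀ q ∈ A.new, p + q ∉ S)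
    (hS' : S' = S ∪ A.new.image (p + ·)) : Rigidifiable S' := by
  subst hS'
  obtain ⟨P, hval, hmem, hlen, hrig⟩ := hS
  have hcell : ∀ q ∈ A.base ∪ A.new, p + q ∈ S ∪ A.new.image (p + ·) := by
    intro q hq
    rcases mem_union.1 hq with h | h
    · exact mem_union_left _ (hbase q h)
    · exact mem_union_right _ (mem_image_of_mem _ h)
  refine ⟨P ++ A.joints.map (Joint.translate p), ?_, ?_, ?_, ?_⟩
  · intro j hj
    rcases List.mem_append.1 hj with h | h
    · exact hval j h
    · obtain ⟨i, hi, rfl⟩ := List.mem_map.1 h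
      exact (A.valid i hi).translate p
  · intro j hj
    rcases List.mem_append.1 hj with h | h
    · exact ⟨mem_union_left _ (hmem j h).1, mem_union_left _ (hmem j h).2⟩
    · obtain ⟨i, hi, rfl⟩ := List.mem_map.1 h
      exact ⟨hcell _ (A.mem i hi).1, hcell _ (A.mem i hi).2⟩
  · have hdisj : Disjoint S (A.new.image (p + ·)) := by
      rw [disjoint_right]
      intro q hq
      obtain ⟨i, hi, rfl⟩ := mem_image.1 hq
      exact hnew i hi
    rw [card_union_of_disjoint hdisj, card_image_of_injective _ (add_right_injective p),
      List.length_append, List.length_map]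
    have := A.length_le
    omega
  · intro m hm
    have hP := hrig m fun j hj => hm j (List.mem_append_left _ hj)
    obtain ⟨q₀, hq₀⟩ : S.Nonempty := by
      rw [← card_pos]
      omega
    suffices h : ∀ q ∈ S ∪ A.new.image (p + ·), m q = m q₀ from
      fun q hq q' hq' => (h q hq).trans (h q' hq').symm
    intro q hq
    rcases mem_union.1 hq with h | h
    · exact hP q h q₀ hq₀
    · obtain ⟨i, hi, rfl⟩ := mem_image.1 h
      rw [← sub_eq_zero]
      -- The attachment lives at the origin, so the relative twists are expressed with origin `p`.
      refine Twist.eq_zero_of_shift (p := p)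
        (A.rigid (fun q => Twist.shift (m (p + q) - m q₀) p) ?_ ?_ i hi)
      · intro q hq
        simp only [hP _ (hbase q hq) q₀ hq₀, sub_self]
        ext c
        fin_cases c <;> simp [Twist.shift, velocity]
      · intro j hj
        have := hm _ (List.mem_append_right _ (List.mem_map_of_mem hj))
        simp only [Joint.Holds, Joint.translate] at this
        simp only [Joint.Holds, velocity_shift, velocity_sub, this]

/-- The motion with its coordinates permuted cyclically. -/
def Twist.rotate (m : Twist) : Twist := ![m 1, m 2, m 0, m 4, m 5, m 3]

/-- The cell with its coordinates permuted cyclically. -/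
def Cell.rotate (q : Cell) : Cell := (q.2.1, q.2.2, q.1)

theorem Cell.rotate_injective : Function.Injective Cell.rotate := by
  rintro ⟨a, b, c⟩ ⟨a', b', c'⟩ h
  simp_all [Cell.rotate]

theorem Twist.rotate_injective : Function.Injective Twist.rotate := by
  intro m m' h
  ext c
  fin_cases c
  exacts [congrFun h 2, congrFun h 0, congrFun h 1, congrFun h 5, congrFun h 3, congrFun h 4]

theorem velocity_rotate (m : Twist) (p : Cell) :
    velocity m.rotate p.rotate = ![velocity m p 1, velocity m p 2, velocity m p 0] := by
  ext c
  fin_cases c <;> simp [velocity, Twist.rotate, Cell.rotate]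

theorem Twist.rotate_surjective : Function.Surjective Twist.rotate := fun m =>
  ⟨![m 2, m 0, m 1, m 5, m 3, m 4], by ext c; fin_cases c <;> rfl⟩

/-- A cyclic permutation of the axes preserves orientation, so it permutes angular and linear
velocities without signs. Hence stacking in the third direction alone is enough. -/
theorem Rigidifiable.rotate {S : Finset Cell} (hS : Rigidifiable S) :
    Rigidifiable (S.image Cell.rotate) := by
  obtain ⟨P, hval, hmem, hlen, hrig⟩ := hS
  refine ⟨P.map fun j => ⟨j.fst.rotate, j.snd.rotate, j.point.rotate⟩, ?_, ?_, ?_, ?_⟩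
  · intro j hj
    obtain ⟨i, hi, rfl⟩ := List.mem_map.1 hj
    obtain ⟨h1, ⟨h2, h3⟩, h4, h5⟩ := hval i hi
    simp only [Prod.le_def] at h2 h3 h4 h5
    exact ⟨fun h => h1 (Cell.rotate_injective h), ⟨⟨h2.2.1, h2.2.2, h2.1⟩, h3.2.1, h3.2.2, h3.1⟩,
      ⟨h4.2.1, h4.2.2, h4.1⟩, h5.2.1, h5.2.2, h5.1⟩
  · intro j hj
    obtain ⟨i, hi, rfl⟩ := List.mem_map.1 hj
    exact ⟨mem_image_of_mem _ (hmem i hi).1, mem_image_of_mem _ (hmem i hi).2⟩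
  · rwa [card_image_of_injective _ Cell.rotate_injective, List.length_map]
  · intro m hm q hq q' hq'
    obtain ⟨r, hr, rfl⟩ := mem_image.1 hq
    obtain ⟨r', hr', rfl⟩ := mem_image.1 hq'
    choose n hn using fun q : Cell => Twist.rotate_surjective (m q.rotate)
    rw [← hn, ← hn, hrig n ?_ r hr r' hr']
    intro j hj
    have h := hm _ (List.mem_map_of_mem hj)
    simp only [Joint.Holds, ← hn, velocity_rotate] at h
    ext c
    fin_cases c
    exacts [congrFun h 2, congrFun h 0, congrFun h 1]

/-! ### Stacking rectangular layers. -/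

/-- A rectangle of cells at height `z`. -/
def block (x y z w h : ℕ) : Finset Cell := Ico x (x + w) ×ˢ Ico y (y + h) ×ˢ {z}

theorem mem_block {x y z w h : ℕ} {q : Cell} : q ∈ block x y z w h ↔
    (x ≤ q.1 ∧ q.1 < x + w) ∧ (y ≤ q.2.1 ∧ q.2.1 < y + h) ∧ q.2.2 = z := by
  simp only [block, mem_product, mem_Ico, mem_singleton]

/-- Rectangles of the given size can be put on top of a rigidifiable set. -/
def Stackable (w h : ℕ) : Prop :=
  ∀ (S : Finset Cell) (x y z : ℕ), Rigidifiable S → block x y z w h ⊆ S →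
    Disjoint S (block x y (z + 1) w h) → Rigidifiable (S ∪ block x y (z + 1) w h)

theorem Stackable.attach_two {w h : ℕ} (A B : Attachment) (a b : ℕ)
    (hA : ∀ q ∈ A.base, q ∈ block 0 0 0 w h) (hB : ∀ q ∈ B.base, (a, b, 0) + q ∈ block 0 0 0 w h)
    (hdisj : Disjoint A.new (B.new.image ((a, b, 0) + ·)))
    (hunion : A.new ∪ B.new.image ((a, b, 0) + ·) = block 0 0 1 w h) : Stackable w h := by
  intro S x y z hS hbase hd
  have himage : ∀ k, (block 0 0 k w h).image ((x, y, z) + ·) = block x y (z + k) w h := by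
    intro k
    ext ⟨i, j, l⟩
    simp only [mem_image, mem_block, Prod.exists, Prod.mk_add_mk, Prod.mk.injEq]
    constructor
    · rintro ⟨_, _, _, h, rfl, rfl, rfl⟩
      omega
    · intro h
      exact ⟨i - x, j - y, k, by omega, by omega, by omega, by omega⟩
  have hbase' : ∀ q ∈ block 0 0 0 w h, (x, y, z) + q ∈ S := fun q hq =>
    hbase (himage 0 ▸ mem_image_of_mem _ hq)
  have hnew : ∀ q ∈ block 0 0 1 w h, (x, y, z) + q ∉ S := fun q hq =>
    disjoint_right.1 hd (himage 1 ▸ mem_image_of_mem _ hq)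
  have hadd : ∀ q : Cell, (x + a, y + b, z) + q = (x, y, z) + ((a, b, 0) + q) := fun q => by
    rw [← add_assoc]
    rfl
  refine (hS.attach A (x, y, z) (fun q hq => hbase' q (hA q hq))
    (fun q hq => hnew q (hunion ▸ mem_union_left _ hq)) rfl).attach B (x + a, y + b, z) ?_ ?_ ?_
  · intro q hq
    rw [hadd]
    exact mem_union_left _ (hbase' _ (hB q hq))
  · intro q hq
    have hq' := mem_image_of_mem ((a, b, 0) + ·) hq
    rw [hadd, mem_union, not_or]
    refine ⟨hnew _ (hunion ▸ mem_union_right _ hq'), fun h => ?_⟩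
    obtain ⟨i, hi, hiq⟩ := mem_image.1 h
    rw [add_left_cancel hiq] at hi
    exact disjoint_left.1 hdisj hi hq'
  · rw [← himage 1, ← hunion, image_union, image_image, union_assoc]
    simp only [hadd, Function.comp_def]

theorem stackable_two_two : Stackable 2 2 := by
  intro S x y z hS hbase hd
  refine hS.attach squareAttachment (x, y, z) ?_ ?_ ?_
  · simp only [squareAttachment, forall_mem_insert, mem_singleton, forall_eq]
    refine ⟨hbase ?_, hbase ?_, hbase ?_, hbase ?_⟩ <;> simp [mem_block]
  · simp only [squareAttachment, forall_mem_insert, mem_singleton, forall_eq]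
    refine ⟨disjoint_right.1 hd ?_, disjoint_right.1 hd ?_, disjoint_right.1 hd ?_,
      disjoint_right.1 hd ?_⟩ <;> simp [mem_block]
  · congr 1
    ext ⟨i, j, l⟩
    simp [squareAttachment, mem_block]
    omega

/-- Two complementary L-trominoes tile the rectangle. -/
theorem stackable_two_three : Stackable 2 3 :=
  .attach_two lowerTrominoAttachment upperTrominoAttachment 0 1
    (by decide) (by decide) (by decide) (by decide)

theorem stackable_three_two : Stackable 3 2 :=
  .attach_two lowerTrominoAttachment upperTrominoAttachment 1 0
    (by decide) (by decide) (by decide) (by decide)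

theorem stackable_three_three : Stackable 3 3 :=
  .attach_two lowerTrominoAttachment ringAttachment 0 0
    (by decide) (by decide) (by decide) (by decide)

/-- The supporting set is arbitrary in `Stackable`, so the second rectangle can be put on the set
already enlarged by the first. -/
theorem Stackable.add_right {w h h' : ℕ} (h₁ : Stackable w h) (h₂ : Stackable w h') :
    Stackable w (h + h') := by
  intro S x y z hS hbase hd
  have hsplit : ∀ k, block x y k w (h + h') = block x y k w h ∪ block x (y + h) k w h' := by
    intro k
    ext q
    simp only [mem_union, mem_block]
    omega
  rw [hsplit] at hbase hd ⊢
  rw [disjoint_union_right] at hd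
  rw [← union_assoc]
  refine h₂ _ x (y + h) z (h₁ S x y z hS (union_subset_left hbase) hd.1)
    ((union_subset_right hbase).trans subset_union_left) (disjoint_union_left.2 ⟨hd.2, ?_⟩)
  rw [disjoint_left]
  intro q
  simp only [mem_block]
  omega

theorem Stackable.add_left {w w' h : ℕ} (h₁ : Stackable w h) (h₂ : Stackable w' h) :
    Stackable (w + w') h := by
  intro S x y z hS hbase hd
  have hsplit : ∀ k, block x y k (w + w') h = block x y k w h ∪ block (x + w) y k w' h := by
    intro k
    ext q
    simp only [mem_union, mem_block]
    omega
  rw [hsplit] at hbase hd ⊢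
  rw [disjoint_union_right] at hd
  rw [← union_assoc]
  refine h₂ _ (x + w) y z (h₁ S x y z hS (union_subset_left hbase) hd.1)
    ((union_subset_right hbase).trans subset_union_left) (disjoint_union_left.2 ⟨hd.2, ?_⟩)
  rw [disjoint_left]
  intro q
  simp only [mem_block]
  omega

theorem induction_from_two_three {p : ℕ → Prop} (h2 : p 2) (h3 : p 3)
    (hadd : ∀ a b, p a → p b → p (a + b)) (n : ℕ) (hn : 2 ≤ n) : p n := by
  induction n using Nat.strong_induction_on with
  | _ n ih =>
    obtain rfl | rfl | h : n = 2 ∨ n = 3 ∨ 4 ≤ n := by omega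
    · exact h2
    · exact h3
    · have := hadd 2 (n - 2) h2 (ih (n - 2) (by omega) (by omega))
      rwa [Nat.add_sub_cancel' hn] at this

theorem stackable {w h : ℕ} (hw : 2 ≤ w) (hh : 2 ≤ h) : Stackable w h :=
  induction_from_two_three (p := fun w => Stackable w h)
    (induction_from_two_three (p := Stackable 2) stackable_two_two stackable_two_three
      (fun _ _ => .add_right) h hh)
    (induction_from_two_three (p := Stackable 3) stackable_three_two stackable_three_three
      (fun _ _ => .add_right) h hh)
    (fun _ _ => .add_left) w hw

/-! ### Growing a cube. -/

/-- The cells of an `a × b × c` assembly. -/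
def box (a b c : ℕ) : Finset Cell := range a ×ˢ range b ×ˢ range c

theorem mem_box {a b c : ℕ} {q : Cell} : q ∈ box a b c ↔ q.1 < a ∧ q.2.1 < b ∧ q.2.2 < c := by
  simp [box]

theorem Rigidifiable.box_mono {a b c c' : ℕ} (ha : 2 ≤ a) (hb : 2 ≤ b) (hc : 1 ≤ c) (hcc : c ≤ c')
    (h : Rigidifiable (box a b c)) : Rigidifiable (box a b c') := by
  induction c', hcc using Nat.le_induction with
  | base => exact h
  | succ n hn ih =>
    -- The supporting layer has height `n - 1`; it exists because `1 ≤ c ≤ n`.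
    have hbox : box a b (n + 1) = box a b n ∪ block 0 0 (n - 1 + 1) a b := by
      ext q
      simp only [mem_union, mem_block, mem_box]
      omega
    rw [hbox]
    refine stackable ha hb _ 0 0 (n - 1) ih ?_ ?_
    · intro q
      simp only [mem_block, mem_box]
      omega
    · rw [disjoint_left]
      intro q
      simp only [mem_block, mem_box]
      omega

theorem Rigidifiable.box_rotate {a b c : ℕ} (h : Rigidifiable (box a b c)) :
    Rigidifiable (box b c a) := by
  convert h.rotate using 1
  ext ⟨i, j, k⟩
  simp only [mem_image, mem_box, Cell.rotate, Prod.exists, Prod.mk.injEq]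
  constructor
  · intro h
    exact ⟨k, i, j, by omega, rfl, rfl, rfl⟩
  · rintro ⟨_, _, _, h, rfl, rfl, rfl⟩
    omega

theorem rigidifiable_box_two_two_one : Rigidifiable (box 2 2 1) := by
  have h : Rigidifiable {(0, 0, 0)} :=
    -- One cell and no joints meet the count exactly: `0 + 2 ≤ 2 * 1`.
    ⟨[], by simp, by simp, by simp, by simp⟩
  exact h.attach cornerAttachment (0, 0, 0) (by decide) (by decide) (by decide)

/-- The sides grow as `2,2,1 → 2,2,L → 2,L,2 → 2,L,L → L,L,2 → L,L,L`, alternating stacking and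
rotation; each stacked layer has both sides at least 2. -/
theorem rigidifiable_box {L : ℕ} (hL : 2 ≤ L) : Rigidifiable (box L L L) :=
  ((rigidifiable_box_two_two_one.box_mono le_rfl le_rfl le_rfl (by omega)).box_rotate.box_mono
    le_rfl hL one_le_two hL).box_rotate.box_mono hL hL one_le_two hL

end

/-! ### Linearised constraints. -/

variable {L M N : ℕ}

theorem hasFDerivAt_distance (c : ℝ) (u v : Node L M N) (x : Config L M N) :
    HasFDerivAt (fun x : Config L M N => ‖position x u - position x v‖ ^ 2 - c)
      (∑ i : Fin 3, (2 * (x (u, i) - x (v, i))) •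
        (ContinuousLinearMap.proj (R := ℝ) (φ := fun _ : Coord L M N => ℝ) (u, i) -
          ContinuousLinearMap.proj (R := ℝ) (φ := fun _ : Coord L M N => ℝ) (v, i))) x := by
  have h : (fun x : Config L M N => ‖position x u - position x v‖ ^ 2 - c) =
      fun x => ∑ i : Fin 3, (x (u, i) - x (v, i)) ^ 2 - c := by
    funext x
    simp [EuclideanSpace.norm_sq_eq, position]
  rw [h]
  refine HasFDerivAt.sub_const c (HasFDerivAt.fun_sum fun i _ => ?_)
  have hp : HasFDerivAt (fun x : Config L M N => x (u, i) - x (v, i))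
      (ContinuousLinearMap.proj (R := ℝ) (φ := fun _ : Coord L M N => ℝ) (u, i) -
          ContinuousLinearMap.proj (R := ℝ) (φ := fun _ : Coord L M N => ℝ) (v, i)) x :=
    (hasFDerivAt_apply _ _).sub (hasFDerivAt_apply _ _)
  simpa using hp.pow 2

theorem rigidityMatrix_mulVec (l : ℝ) (diag : Cube L M N → CubeFace → Bool)
    (P : Finset (Sym2 (Node L M N))) (x : Config L M N) (i : Constraint P) :
    (rigidityMatrix l diag P).mulVec x i = fderiv ℝ (constraintFun l diag P i) (rest l L M N) x := by
  conv_rhs => rw [pi_eq_sum_univ' x, map_sum]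
  simp only [Matrix.mulVec, dotProduct, rigidityMatrix, Matrix.of_apply, map_smul, smul_eq_mul]
  refine Finset.sum_congr rfl fun j _ => ?_
  rw [mul_comm]

/-- The change of the squared distance of two nodes vanishes to first order. -/
def PreservesDistance (x : Config L M N) (u v : Node L M N) : Prop :=
  ∑ i : Fin 3, ((gridPoint u i : ℝ) - gridPoint v i) * (x (u, i) - x (v, i)) = 0

theorem preservesDistance_of_fderiv {l : ℝ} (hl : l ≠ 0) (c : ℝ) {u v : Node L M N}
    {x : Config L M N}
    (h : fderiv ℝ (fun x : Config L M N => ‖position x u - position x v‖ ^ 2 - c)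
      (rest l L M N) x = 0) : PreservesDistance x u v := by
  rw [(hasFDerivAt_distance c u v _).fderiv] at h
  -- The 2 comes from differentiating squares, the `l` from scaling grid points to rest positions.
  refine (mul_eq_zero.1 (?_ : (2 * l) * _ = 0)).resolve_left (by simpa using hl)
  rw [← h, Finset.mul_sum]
  simp only [sum_apply, smul_apply,
    sub_apply, ContinuousLinearMap.proj_apply, smul_eq_mul, rest]
  exact Finset.sum_congr rfl fun i _ => by ring

theorem eq_of_fderiv_link {p q : Coord L M N} {x y : Config L M N}
    (h : fderiv ℝ (fun x : Config L M N => x p - x q) y x = 0) : x p = x q := by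
  have hp : HasFDerivAt (fun x : Config L M N => x p - x q)
      (ContinuousLinearMap.proj (R := ℝ) (φ := fun _ : Coord L M N => ℝ) p -
          ContinuousLinearMap.proj (R := ℝ) (φ := fun _ : Coord L M N => ℝ) q) y :=
    (hasFDerivAt_apply _ _).sub (hasFDerivAt_apply _ _)
  rw [hp.fderiv] at h
  exact sub_eq_zero.1 h

/-! ### Infinitesimal rigidity of a single cell. -/

/-- The lowest corner of a cube. -/
def Cube.toCell (q : Cube L M N) : Cell := (q.1, q.2.1, q.2.2)

/-- The undeformed place of a node. -/
def Node.place (v : Node L M N) : Cell := (gridPoint v 0, gridPoint v 1, gridPoint v 2)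

theorem insertNth_corner (s a b : Bool) :
    (Fin.insertNth 0 s ![a, b] : Corner) = ![s, a, b] ∧
    (Fin.insertNth 1 s ![a, b] : Corner) = ![a, s, b] ∧
    (Fin.insertNth 2 s ![a, b] : Corner) = ![a, b, s] := by
  revert s a b
  decide

/-- The inner product of the difference of two corners with the difference of their velocities. -/
def stretch (y : Corner → Fin 3 → ℝ) (b b' : Corner) : ℝ :=
  ∑ i, (((b i).toNat : ℝ) - (b' i).toNat) * (y b i - y b' i)

/-- The edges make each velocity component independent of its own coordinate, leaving 12 unknowns.
Each face adds one relation, and the resulting linear system has only twists as solutions. -/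
theorem exists_twist_of_stretch_eq_zero {y : Corner → Fin 3 → ℝ} {d : CubeFace → Bool}
    (hedge : ∀ e, stretch y (edgeEnds e).1 (edgeEnds e).2 = 0)
    (hdiag : ∀ f, stretch y (diagonalEnds f (d f)).1 (diagonalEnds f (d f)).2 = 0) :
    ∃ m : Twist, ∀ b : Corner,
      y b = velocity m ((b 0).toNat, (b 1).toNat, (b 2).toNat) := by
  have h0 : ∀ a b, y ![true, a, b] 0 = y ![false, a, b] 0 := fun a b => by
    have := hedge (0, ![a, b])
    simp [edgeEnds, (insertNth_corner _ a b).1, stretch, Fin.sum_univ_three] at this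
    linarith
  have h1 : ∀ a b, y ![a, true, b] 1 = y ![a, false, b] 1 := fun a b => by
    have := hedge (1, ![a, b])
    simp [edgeEnds, (insertNth_corner _ a b).2.1, stretch, Fin.sum_univ_three] at this
    linarith
  have h2 : ∀ a b, y ![a, b, true] 2 = y ![a, b, false] 2 := fun a b => by
    have := hedge (2, ![a, b])
    simp [edgeEnds, (insertNth_corner _ a b).2.2, stretch, Fin.sum_univ_three] at this
    linarith
  have d0 : ∀ s, y ![s, false, true] 1 - y ![s, false, false] 1 +
      (y ![s, true, false] 2 - y ![s, false, false] 2) = 0 := fun s => by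
    have := hdiag (0, s)
    -- Modulo the edge relations, both diagonals of a face give the same equation.
    cases h : d (0, s) <;>
      simp [diagonalEnds, (insertNth_corner _ _ _).1, stretch, Fin.sum_univ_three,
        h, h1, h2] at this <;>
      linarith
  have d1 : ∀ s, y ![false, s, true] 0 - y ![false, s, false] 0 +
      (y ![true, s, false] 2 - y ![false, s, false] 2) = 0 := fun s => by
    have := hdiag (1, s)
    cases h : d (1, s) <;>
      simp [diagonalEnds, (insertNth_corner _ _ _).2.1, stretch, Fin.sum_univ_three,
        h, h0, h2] at this <;>
      linarith
  have d2 : ∀ s, y ![false, true, s] 0 - y ![false, false, s] 0 +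
      (y ![true, false, s] 1 - y ![false, false, s] 1) = 0 := fun s => by
    have := hdiag (2, s)
    cases h : d (2, s) <;>
      simp [diagonalEnds, (insertNth_corner _ _ _).2.2, stretch, Fin.sum_univ_three,
        h, h0, h1] at this <;>
      linarith
  -- The twist is read off at the lowest corner and its three neighbours.
  refine ⟨![y ![false, true, false] 2 - y ![false, false, false] 2,
    y ![false, false, true] 0 - y ![false, false, false] 0,
    y ![true, false, false] 1 - y ![false, false, false] 1,
    y ![false, false, false] 0, y ![false, false, false] 1, y ![false, false, false] 2],
    fun b => ?_⟩
  have hb : b = ![b 0, b 1, b 2] := by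
    ext i
    fin_cases i <;> rfl
  have d0f := d0 false
  have d0t := d0 true
  have d1f := d1 false
  have d1t := d1 true
  have d2f := d2 false
  have d2t := d2 true
  rw [hb]
  generalize b 0 = b₀
  generalize b 1 = b₁
  generalize b 2 = b₂
  ext i
  fin_cases i <;> cases b₀ <;> cases b₁ <;> cases b₂ <;> simp [velocity, h0, h1, h2] at * <;>
    linarith

theorem Twist.shift_surjective (p : Cell) : Function.Surjective fun m : Twist => m.shift p :=
  fun m => ⟨![m 0, m 1, m 2, m 3 - (m 1 * p.2.2 - m 2 * p.2.1), m 4 - (m 2 * p.1 - m 0 * p.2.2),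
    m 5 - (m 0 * p.2.1 - m 1 * p.1)], by
      ext c
      fin_cases c <;> simp [Twist.shift, velocity] <;> ring⟩

theorem place_eq (q : Cube L M N) (b : Corner) :
    Node.place (q, b) = q.toCell + ((b 0).toNat, (b 1).toNat, (b 2).toNat) := rfl

theorem cube_rigid {x : Config L M N} {q : Cube L M N} {d : CubeFace → Bool}
    (hedge : ∀ e, PreservesDistance x (q, (edgeEnds e).1) (q, (edgeEnds e).2))
    (hdiag : ∀ f, PreservesDistance x (q, (diagonalEnds f (d f)).1)
      (q, (diagonalEnds f (d f)).2)) :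
    ∃ m : Twist, ∀ (b : Corner) (c : Fin 3), x ((q, b), c) = velocity m (Node.place (q, b)) c := by
  have hstretch : ∀ b b', PreservesDistance x (q, b) (q, b') →
      stretch (fun b c => x ((q, b), c)) b b' = 0 := by
    intro b b' h
    rw [← show _ = (0 : ℝ) from h, stretch]
    refine Finset.sum_congr rfl fun i _ => ?_
    congr 1
    fin_cases i <;> simp [gridPoint]
  obtain ⟨m, hm⟩ := exists_twist_of_stretch_eq_zero (fun e => hstretch _ _ (hedge e))
    (fun f => hstretch _ _ (hdiag f))
  obtain ⟨m, rfl⟩ := Twist.shift_surjective q.toCell m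
  refine ⟨m, fun b c => ?_⟩
  rw [place_eq, ← velocity_shift]
  exact congrFun (hm b) c

theorem exists_twists_of_mulVec_eq_zero {l : ℝ} (hl : l ≠ 0)
    {diag : Cube L M N → CubeFace → Bool} {P : Finset (Sym2 (Node L M N))} {x : Config L M N}
    (hx : (rigidityMatrix l diag P).mulVec x = 0) :
    ∃ m : Cube L M N → Twist,
      (∀ (v : Node L M N) (c : Fin 3), x (v, c) = velocity (m v.1) v.place c) ∧
      ∀ u v, s(u, v) ∈ P → ∀ c, x (u, c) = x (v, c) := by
  have hfd : ∀ i, fderiv ℝ (constraintFun l diag P i) (rest l L M N) x = 0 := fun i => by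
    rw [← rigidityMatrix_mulVec, hx, Pi.zero_apply]
  have hcube : ∀ q, ∃ m : Twist, ∀ (b : Corner) (c : Fin 3),
      x ((q, b), c) = velocity m (Node.place (q, b)) c := fun q =>
    cube_rigid (d := diag q)
      (fun e => preservesDistance_of_fderiv hl _ (hfd (.inl (q, e))))
      (fun f => preservesDistance_of_fderiv hl _ (hfd (.inr (.inl (q, f)))))
  choose m hm using hcube
  refine ⟨m, fun v c => hm v.1 v.2 c, fun u v huv c => ?_⟩
  have h := eq_of_fderiv_link (hfd (.inr (.inr (⟨s(u, v), huv⟩, c))))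
  have hout : s((Quot.out s(u, v)).1, (Quot.out s(u, v)).2) = s(u, v) := Quot.out_eq _
  -- The representative of an unordered link may have either orientation.
  rcases Sym2.eq_iff.1 hout with ⟨h1, h2⟩ | ⟨h1, h2⟩
  · rwa [h1, h2] at h
  · rw [h1, h2] at h
    exact h.symm

/-! ### Rank bounds and the link pattern. -/

/-- The velocities that a common motion of all cubes gives to the coordinates. -/
def rigidMotion (L M N : ℕ) : Twist →ₗ[ℝ] Config L M N where
  toFun m p := velocity m p.1.place p.2
  map_add' m m' := by
    ext ⟨v, c⟩
    fin_cases c <;> simp [velocity] <;> ring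
  map_smul' a m := by
    ext ⟨v, c⟩
    fin_cases c <;> simp [velocity] <;> ring

theorem card_coord : Fintype.card (Coord L M N) = 24 * L * M * N := by
  simp [Fintype.card_prod]
  ring

/-- Rank-nullity: the kernel lies in the image of a six-dimensional space. That rigid motions do lie
in the kernel need not be shown, as the row count supplies the opposite bound. -/
theorem le_rank_of_ker_le {l : ℝ} {diag : Cube L M N → CubeFace → Bool}
    {P : Finset (Sym2 (Node L M N))}
    (h : ∀ x, (rigidityMatrix l diag P).mulVec x = 0 → x ∈ (rigidMotion L M N).range) :
    24 * L * M * N ≤ (rigidityMatrix l diag P).rank + 6 := by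
  have hker : (rigidityMatrix l diag P).mulVecLin.ker ≤ (rigidMotion L M N).range := fun x hx =>
    h x (by simpa using hx)
  have h2 := (Submodule.finrank_mono hker).trans (rigidMotion L M N).finrank_range_le
  have h3 := (rigidityMatrix l diag P).mulVecLin.finrank_range_add_finrank_ker
  rw [Module.finrank_fintype_fun_eq_card, card_coord] at h3
  rw [Module.finrank_fintype_fun_eq_card, Fintype.card_fin] at h2
  rw [Matrix.rank]
  omega

theorem rank_le (l : ℝ) (diag : Cube L M N → CubeFace → Bool) (P : Finset (Sym2 (Node L M N))) :
    (rigidityMatrix l diag P).rank ≤ 18 * (L * M * N) + 3 * P.card := by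
  refine (Matrix.rank_le_card_height _).trans_eq ?_
  simp [Fintype.card_sum, Fintype.card_prod]
  ring

/-- The node of the given cube that lies at the grid point `p`. -/
def nodeAt (q : Cube L M N) (p : Cell) : Node L M N :=
  (q, ![decide (q.toCell.1 < p.1), decide (q.toCell.2.1 < p.2.1), decide (q.toCell.2.2 < p.2.2)])

theorem place_nodeAt {q : Cube L M N} {p : Cell} (h : IsCornerOf p q.toCell) :
    (nodeAt q p).place = p := by
  have hbit : ∀ a b : ℕ, a ≤ b → b ≤ a + 1 → a + (decide (a < b)).toNat = b := by
    intro a b h1 h2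
    rcases h1.eq_or_lt with rfl | h
    · simp
    · simp only [h, decide_true, Bool.toNat_true]
      omega
  obtain ⟨⟨h1, h2, h3⟩, h4, h5, h6⟩ := h
  exact Prod.ext (hbit _ _ h1 h4) (Prod.ext (hbit _ _ h2 h5) (hbit _ _ h3 h6))

theorem gridPoint_eq_of_place_eq {u v : Node L M N} (h : u.place = v.place) :
    gridPoint u = gridPoint v := by
  obtain ⟨h0, h1, h2⟩ : gridPoint u 0 = gridPoint v 0 ∧ gridPoint u 1 = gridPoint v 1 ∧
      gridPoint u 2 = gridPoint v 2 := by
    simpa [Node.place] using h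
  ext c
  fin_cases c <;> assumption

theorem exists_toCell {q : Cell} (h : q ∈ box L M N) : ∃ r : Cube L M N, r.toCell = q := by
  rw [mem_box] at h
  exact ⟨(⟨q.1, h.1⟩, ⟨q.2.1, h.2.1⟩, ⟨q.2.2, h.2.2⟩), rfl⟩

theorem toCell_mem_box (q : Cube L M N) : q.toCell ∈ box L M N :=
  mem_box.2 ⟨q.1.2, q.2.1.2, q.2.2.2⟩

theorem exists_linkPattern (hbox : Rigidifiable (box L M N)) {l : ℝ} (hl : l ≠ 0)
    (diag : Cube L M N → CubeFace → Bool) :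
    ∃ P : Finset (Sym2 (Node L M N)), IsLinkPattern P ∧ P.card + 2 ≤ 2 * (L * M * N) ∧
      24 * L * M * N ≤ (rigidityMatrix l diag P).rank + 6 := by
  classical
  obtain ⟨J, hval, hmem, hlen, hrig⟩ := hbox
  have hcard : (box L M N).card = L * M * N := by
    simp [box, mul_assoc]
  rw [hcard] at hlen
  have hpos : 0 < L * M * N := by omega
  obtain ⟨q₀, hq₀⟩ : ∃ q₀ : Cell, q₀ ∈ box L M N := by
    rwa [← Finset.Nonempty, ← Finset.card_pos, hcard]
  obtain ⟨r₀, rfl⟩ := exists_toCell hq₀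
  have : Nonempty (Cube L M N) := ⟨r₀⟩
  choose! r hr using fun (q : Cell) (h : q ∈ box L M N) => exists_toCell h
  have hr' : ∀ q : Cube L M N, r q.toCell = q := fun q => by
    have h := hr _ (toCell_mem_box q)
    simp only [Cube.toCell, Prod.mk.injEq] at h
    exact Prod.ext (Fin.ext h.1) (Prod.ext (Fin.ext h.2.1) (Fin.ext h.2.2))
  have hfst : ∀ j ∈ J, (nodeAt (r j.fst) j.point).place = j.point := fun j hj =>
    place_nodeAt (by rw [hr _ (hmem j hj).1]; exact (hval j hj).2.1)
  have hsnd : ∀ j ∈ J, (nodeAt (r j.snd) j.point).place = j.point := fun j hj =>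
    place_nodeAt (by rw [hr _ (hmem j hj).2]; exact (hval j hj).2.2)
  let link : Joint → Sym2 (Node L M N) := fun j =>
    s(nodeAt (r j.fst) j.point, nodeAt (r j.snd) j.point)
  refine ⟨(J.map link).toFinset, ?_, ?_, le_rank_of_ker_le fun x hx => ?_⟩
  · intro e he
    obtain ⟨j, hj, rfl⟩ := List.mem_map.1 (List.mem_toFinset.1 he)
    refine ⟨fun h => (hval j hj).1 ?_,
      gridPoint_eq_of_place_eq ((hfst j hj).trans (hsnd j hj).symm)⟩
    rw [← hr _ (hmem j hj).1, ← hr _ (hmem j hj).2]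
    exact congrArg Cube.toCell h
  -- Different joints might give the same link, so only an upper bound on the number of links is
  -- obtained here.
  · have := (J.map link).toFinset_card_le
    rw [List.length_map] at this
    omega
  · obtain ⟨m, hm, hlink⟩ := exists_twists_of_mulVec_eq_zero hl hx
    refine ⟨m r₀, ?_⟩
    have hall := hrig (fun q => m (r q)) fun j hj => by
      ext c
      have h := hlink _ _ (List.mem_toFinset.2 (List.mem_map_of_mem (f := link) hj)) c
      rwa [hm, hm, hfst j hj, hsnd j hj] at h
    ext ⟨v, c⟩
    have h := hall _ (toCell_mem_box r₀) _ (toCell_mem_box v.1)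
    simp only [hr'] at h
    rw [hm, ← h]
    rfl

end PrismaticAssembly

end

theorem theorem1 (L : ℕ) (hL : 2 ≤ L) (l : ℝ) (hl : 0 < l)
    (diag : PrismaticAssembly.Cube L L L → PrismaticAssembly.CubeFace → Bool) :
    IsLeast (PrismaticAssembly.rigidifyingNumbers l diag) (2 * L ^ 3 - 2) := by
  have hcube : 24 * L * L * L = 24 * L ^ 3 := by ring
  have hcube' : L * L * L = L ^ 3 := by ring
  have hL3 : 8 ≤ L ^ 3 := (by norm_num : 8 = 2 ^ 3).trans_le (Nat.pow_le_pow_left hL 3)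
  constructor
  · obtain ⟨P, hP, hcard, hrank⟩ :=
      PrismaticAssembly.exists_linkPattern (PrismaticAssembly.rigidifiable_box hL) hl.ne' diag
    have hle := PrismaticAssembly.rank_le l diag P
    refine ⟨P, hP, ?_, ?_⟩
    -- The rank is at least `24 L³ - 6`, so the row count forces at least `2 L³ - 2` links, matching
    -- the upper bound.
    · omega
    · rw [PrismaticAssembly.dof]
      omega
  · rintro n ⟨P, -, rfl, hdof⟩
    have hle := PrismaticAssembly.rank_le l diag P
    rw [PrismaticAssembly.dof] at hdof
    omega
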